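/- Fix an integer $k\ge 1$ and let $[k]^\omega=\bigcup_{n\ge1}[k]^n$ be the set of nonempty finite words over $[k]=\{1,\dots,k\}$. An infinite-dimensional subspace of $[k]^\omega$ is a map $\phi:[k]^\omega\to[k]^\omega$ given by integers $0=N_0<N_1<N_2<\cdots$, nonempty sets $I_i\subseteq\{N_{i-1}+1,\dots,N_i\}$ $(i\ge1)$ and letters $w_m\in[k]$ $(m\ge1)$: for $v=v_1\cdots v_n$, $\phi(v)$ is the word of length $N_n$ whose $m$-th letter, for $N_{i-1}<m\le N_i$, is $v_i$ if $m\in I_i$ and $w_m$ otherwise. A combinatorial line is a map $\ell:[k]\to[k]^n$, for some $n\ge 1$, given by a nonempty set $I\subseteq[n]$ and letters $w_m$ for $m\in[n]\setminus I$: the $m$-th letter of $\ell(i)$ is $i$ if $m\in I$ and $w_m$ otherwise. For a standard Borel space $(X,\Sigma)$, a law on $X^{[k]^\omega}$ is a probability measure $\mu$ on the product $\sigma$-algebra. It is strongly stationary (s.s.) if, for every infinite-dimensional subspace $\phi$, the image of $\mu$ under $(x_v)_v\mapsto(x_{\phi(v)})_v$ is $\mu$. For an s.s. law all one-coordinate marginals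 coincide; denote the common one by $\mu^\circ$. An extension of $\mu$ is a law $\tilde\mu$ on $\tilde X^{[k]^\omega}$, with $\tilde X$ standard Borel, together with a Borel map $\pi:\tilde X\to X$ whose coordinatewise action pushes $\tilde\mu$ forward to $\mu$. For $e\subseteq[k]$ let $\Phi_e$ be the $\sigma$-algebra of all $A\in\Sigma$ such that, for every combinatorial line $\ell$ and all $i,j\in e$, $1_A(x_{\ell(i)})=1_A(x_{\ell(j)})$ for $\mu$-almost every $x$. Let $\binom{[k]}{\ge2}$ be the family of subsets of $[k]$ with at least two elements; a family $\mathcal I\subseteq\binom{[k]}{\ge2}$ is an up-set if $u\in\mathcal I$ and $u\subseteq v\subseteq[k]$ imply $v\in\mathcal I$. Put $\Phi_{\mathcal I}=\bigvee_{e\in\mathcal I}\Phi_e$. Write $\tilde\Phi_{\mathcal I}$ for the corresponding $\sigma$-algebra of a law $\tilde\mu$. An s.s. law $\mu$ is fully sated if for every nonempty up-set $\mathcal I\subseteq\binom{[k]}{\ge2}$ and every s.s. extension $\tilde\mu$ of $\mu$ through a map $\pi$, the $\sigma$-algebras $\pi^{-1}(\Sigma)$ and $\tilde\Phi_{\mathcal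 I}$ are relatively (i.e. conditionally) independent under $\tilde\mu^\circ$ over $\pi^{-1}(\Phi_{\mathcal I})$. **Theorem (Sated extension).** Every strongly stationary law has a fully sated strongly stationary extension. -/

import Mathlib

open MeasureTheory ProbabilityTheory

universe u

namespace DHJ

/-- The infinite-dimensional combinatorial space `[k]^ω = ⋃ n ≥ 1, [k]^n` of nonempty finite words
over the alphabet `[k]`, which is modelled by `Fin k`; positions are numbered from `0`. -/
abbrev Word (k : ℕ) : Type := Σ n : ℕ+, (Fin n → Fin k)

/-- The data of an infinite-dimensional subspace of `[k]^ω`: end points `0 = N 0 < N 1 < N 2 < ⋯`,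
nonempty sets `I i` of active positions in the `i`-th block `{N i, …, N (i + 1) - 1}`, and the
letters `w m` at the fixed positions. -/
structure CSubspace (k : ℕ) where
  N : ℕ → ℕ
  N_zero : N 0 = 0
  N_strictMono : StrictMono N
  I : ℕ → Finset ℕ
  I_nonempty : ∀ i, (I i).Nonempty
  I_subset : ∀ i, I i ⊆ Finset.Ico (N i) (N (i + 1))
  w : ℕ → Fin k

namespace CSubspace

variable {k : ℕ} (φ : CSubspace k)

/-- The index `i` of the block `N i ≤ m < N (i + 1)` that contains the position `m`. -/
def block (m : ℕ) : ℕ := Nat.findGreatest (fun i => φ.N i ≤ m) m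

theorem N_block_le (m : ℕ) : φ.N (φ.block m) ≤ m :=
  Nat.findGreatest_spec (P := fun i => φ.N i ≤ m) (Nat.zero_le m) (by simp [φ.N_zero])

theorem lt_N_block_succ (m : ℕ) : m < φ.N (φ.block m + 1) := by
  by_contra! h
  have h1 : φ.block m + 1 ≤ m := (φ.N_strictMono.le_apply).trans h
  have h2 := Nat.le_findGreatest (P := fun i => φ.N i ≤ m) h1 h
  exact absurd h2 (Nat.not_succ_le_self _)

theorem block_lt {m n : ℕ} (h : m < φ.N n) : φ.block m < n :=
  φ.N_strictMono.lt_iff_lt.1 ((φ.N_block_le m).trans_lt h)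

theorem N_pos (n : ℕ+) : 0 < φ.N n :=
  lt_of_le_of_lt (Nat.zero_le _) (φ.N_strictMono n.pos)

/-- The subspace as a map `[k]^ω → [k]^ω`: a word `v` of length `n` goes to the word of length
`N n` whose letter at a position `m` of the `i`-th block is `v i` if `m` is active, and `w m` if it
is not. -/
def toFun (v : Word k) : Word k :=
  ⟨⟨φ.N v.1, φ.N_pos v.1⟩, fun m =>
    if (m : ℕ) ∈ φ.I (φ.block m) then v.2 ⟨φ.block m, φ.block_lt m.2⟩ else φ.w m⟩

instance : CoeFun (CSubspace k) (fun _ => Word k → Word k) := ⟨toFun⟩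

end CSubspace

section Laws

variable {k : ℕ} {X Y : Type u} [MeasurableSpace X] [MeasurableSpace Y]

/-- Strong stationarity: `φ^* μ = μ` for every infinite-dimensional subspace `φ`, where `φ^* μ` is
the law of `(x_{φ(v)})_v` for `x` distributed according to `μ`. -/
def IsStronglyStationary (μ : Measure (Word k → X)) : Prop :=
  ∀ φ : CSubspace k, μ.map (fun x v => x (φ v)) = μ

/-- `ν` is an extension of the law `μ` through the Borel map `π`: the coordinatewise action of `π`
pushes `ν` forward to `μ`. -/
structure IsExtension (ν : Measure (Word k → Y)) (μ : Measure (Word k → X)) (π : Y → X) :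
    Prop where
  measurable : Measurable π
  map_eq : ν.map (fun y w => π (y w)) = μ

/-- The point-marginal `μ°`: the distribution of one coordinate. For a strongly stationary law it is
the same for all words, so we take the one-letter word made of the first letter. -/
noncomputable abbrev pointMarginal [NeZero k] (μ : Measure (Word k → X)) : Measure X :=
  μ.map (fun x => x ⟨1, fun _ => 0⟩)

/-- The `e`-insensitive σ-algebra `Φ_e`: the measurable sets `A` such that, for every combinatorial
line `ℓ` and all `i, j ∈ e`, almost surely `x_{ℓ(i)} ∈ A` if and only if `x_{ℓ(j)} ∈ A`. -/
def insensitive (μ : Measure (Word k → X)) (e : Finset (Fin k)) : MeasurableSpace X where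
  MeasurableSet' A := MeasurableSet A ∧
    ∀ (n : ℕ+) (ℓ : Combinatorics.Line (Fin k) (Fin n)), ∀ i ∈ e, ∀ j ∈ e,
      ∀ᵐ x ∂μ, x ⟨n, ℓ i⟩ ∈ A ↔ x ⟨n, ℓ j⟩ ∈ A
  measurableSet_empty := by simp
  measurableSet_compl := by
    rintro A ⟨hA, h⟩
    refine ⟨hA.compl, fun n ℓ i hi j hj => ?_⟩
    filter_upwards [h n ℓ i hi j hj] with x hx
    simpa using not_congr hx
  measurableSet_iUnion := by
    intro A hA
    refine ⟨MeasurableSet.iUnion fun r => (hA r).1, fun n ℓ i hi j hj => ?_⟩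
    filter_upwards [ae_all_iff.2 fun r => (hA r).2 n ℓ i hi j hj] with x hx
    simp [hx]

/-- The σ-algebra `Φ_𝓘`: the join of the `Φ_e` with `e ∈ 𝓘`. -/
def insensitiveJoin (μ : Measure (Word k → X)) (𝓘 : Set (Finset (Fin k))) : MeasurableSpace X :=
  ⨆ e ∈ 𝓘, insensitive μ e

theorem insensitiveJoin_le (μ : Measure (Word k → X)) (𝓘 : Set (Finset (Fin k))) :
    insensitiveJoin μ 𝓘 ≤ (inferInstance : MeasurableSpace X) :=
  iSup₂_le fun _ _ _ hA => hA.1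

theorem comap_insensitiveJoin_le (μ : Measure (Word k → X)) (𝓘 : Set (Finset (Fin k)))
    {π : Y → X} (hπ : Measurable π) :
    (insensitiveJoin μ 𝓘).comap π ≤ (inferInstance : MeasurableSpace Y) :=
  (MeasurableSpace.comap_mono (insensitiveJoin_le μ 𝓘)).trans hπ.comap_le

/-- `μ` is `𝓘`-sated: for every strongly stationary extension `ν` of `μ`, through `π : Y → X`, the
σ-algebra generated by `π` and the σ-algebra `Φ_𝓘` of `ν` are conditionally independent under `ν°`
given the preimage under `π` of the σ-algebra `Φ_𝓘` of `μ`. (Every standard Borel space is Borel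
isomorphic to one in the universe of `X`, so that universe is large enough.) -/
def IsSated [NeZero k] (μ : Measure (Word k → X)) (𝓘 : Set (Finset (Fin k))) : Prop :=
  ∀ (Y : Type u) [MeasurableSpace Y] [StandardBorelSpace Y]
    (ν : Measure (Word k → Y)) [IsProbabilityMeasure ν] (π : Y → X),
    IsStronglyStationary ν → ∀ hπ : IsExtension ν μ π,
      CondIndep ((insensitiveJoin μ 𝓘).comap π)
        (MeasurableSpace.comap π inferInstance) (insensitiveJoin ν 𝓘)
        (comap_insensitiveJoin_le μ 𝓘 hπ.measurable) (pointMarginal ν)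

/-- `μ` is fully sated: it is `𝓘`-sated for every nonempty up-set `𝓘` in the family of the subsets
of `[k]` with at least two elements. -/
def IsFullySated [NeZero k] (μ : Measure (Word k → X)) : Prop :=
  ∀ 𝓘 : Set (Finset (Fin k)), 𝓘.Nonempty → (∀ e ∈ 𝓘, 2 ≤ e.card) → IsUpperSet 𝓘 → IsSated μ 𝓘

end Laws

end DHJ

/-!
The proof is an energy increment. For a set `A` in the base space of a strongly stationary law `μ`
and a family `𝓘`, the energy of `A` is the squared `L²(μ°)` norm of the conditional probability of
`A` given `Φ_𝓘`. Preimages of insensitive sets under an extension are insensitive, so energies only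
grow under extensions (`IsExtension.insensitiveEnergy_le`), and they are bounded by `1`. If the
energy of `A` does not grow under an extension through `π`, then by Pythagoras
(`integral_sq_sub_condProb`) the conditional probabilities of `π⁻¹ A` given `Φ_𝓘` of the extension
and given `π⁻¹ Φ_𝓘` agree, which makes `π⁻¹ A` conditionally independent of `Φ_𝓘` of the extension
over `π⁻¹ Φ_𝓘` (`condProb_inter_of_condProb_eq`). So a law is `𝓘`-sated once no extension increases
the energy of the sets of sufficiently rich π-systems (`IsSated.of_inverseLimit`).

Such a law is the limit of a sequence of extensions, each of which makes the energy of one set, for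
one `𝓘`, maximal up to a prescribed error. Standard Borel spaces are countably generated and there
are finitely many `𝓘`, so that countably many tasks suffice for all stages together, and each is
carried out with errors tending to `0` (`StationaryLaw.exists_extension_sequence`). An extension of
the limit extends every stage, hence cannot increase any of these energies.

The inverse limit (`StationaryLaw.exists_inverseLimit`) lives on the space of threads. Its law comes
from the Ionescu-Tulcea theorem, applied to the disintegrations of each law over the preceding one
(`exists_measure_pi_of_map_eq`). Strong stationarity passes to the limit since a law on threads is
determined by its images at the stages (`StationaryLaw.Thread.measure_ext`).
-/

namespace DHJ

/-! ### Conditional probabilities and their energy -/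

section CondEnergy

variable {Ω Ω' : Type*} {mΩ : MeasurableSpace Ω} {mΩ' : MeasurableSpace Ω'}

/-- The conditional probability `ρ⟦A | m⟧`, as a function. -/
noncomputable abbrev condProb (ρ : Measure Ω) (m : MeasurableSpace Ω) (A : Set Ω) : Ω → ℝ :=
  ρ⟦A | m⟧

/-- The energy of the set `A` with respect to the σ-algebra `m`: the square of the `L²` norm of the
conditional probability of `A` given `m`. -/
noncomputable def condEnergy (ρ : Measure Ω) (m : MeasurableSpace Ω) (A : Set Ω) : ℝ :=
  ∫ x, (condProb ρ m A x) ^ 2 ∂ρ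

theorem integrable_indicator_one (ρ : Measure Ω) [IsFiniteMeasure ρ] {A : Set Ω}
    (hA : MeasurableSet[mΩ] A) : Integrable (A.indicator fun _ => (1 : ℝ)) ρ :=
  (integrable_const 1).indicator hA

theorem condProb_mem_Icc (ρ : Measure Ω) [IsFiniteMeasure ρ] {m : MeasurableSpace Ω}
    (hm : m ≤ mΩ) {A : Set Ω} (hA : MeasurableSet[mΩ] A) :
    ∀ᵐ x ∂ρ, condProb ρ m A x ∈ Set.Icc (0 : ℝ) 1 := by
  have h0 : 0 ≤ᵐ[ρ] condProb ρ m A :=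
    condExp_nonneg (ae_of_all _ (Set.indicator_nonneg fun _ _ => zero_le_one))
  have h1 : condProb ρ m A ≤ᵐ[ρ] ρ[fun _ => (1 : ℝ) | m] :=
    condExp_mono (integrable_indicator_one ρ hA) (integrable_const 1)
      (ae_of_all _ (Set.indicator_le_self' fun _ _ => zero_le_one))
  rw [condExp_const hm] at h1
  filter_upwards [h0, h1] with x hx0 hx1 using ⟨hx0, hx1⟩

theorem integrable_condProb_mul (ρ : Measure Ω) [IsFiniteMeasure ρ] {m m' : MeasurableSpace Ω}
    (hm : m ≤ mΩ) {A : Set Ω} (hA : MeasurableSet[mΩ] A) :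
    Integrable (fun x => condProb ρ m A x * condProb ρ m' A x) ρ := by
  refine (integrable_condExp (m := m')).bdd_mul (c := 1)
    (stronglyMeasurable_condExp.mono hm).aestronglyMeasurable ?_
  filter_upwards [condProb_mem_Icc ρ hm hA] with x hx
  rw [Real.norm_of_nonneg hx.1]
  exact hx.2

theorem condEnergy_le_one (ρ : Measure Ω) [IsProbabilityMeasure ρ] {m : MeasurableSpace Ω}
    (hm : m ≤ mΩ) {A : Set Ω} (hA : MeasurableSet[mΩ] A) : condEnergy ρ m A ≤ 1 := by
  have h : condEnergy ρ m A ≤ ∫ _, (1 : ℝ) ∂ρ := by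
    refine integral_mono_ae ?_ (integrable_const 1) ?_
    · simpa only [sq] using integrable_condProb_mul ρ (m' := m) hm hA
    · filter_upwards [condProb_mem_Icc ρ hm hA] with x hx
      exact pow_le_one₀ hx.1 hx.2
  simpa using h

/-- Pythagoras: the energy gained by passing to a finer σ-algebra is the squared `L²` distance of
the two conditional probabilities. -/
theorem integral_sq_sub_condProb (ρ : Measure Ω) [IsFiniteMeasure ρ] {m m' : MeasurableSpace Ω}
    (hmm : m ≤ m') (hm' : m' ≤ mΩ) {A : Set Ω} (hA : MeasurableSet[mΩ] A) :
    ∫ x, (condProb ρ m' A x - condProb ρ m A x) ^ 2 ∂ρ = condEnergy ρ m' A - condEnergy ρ m A := by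
  have hm : m ≤ mΩ := hmm.trans hm'
  have i1 := integrable_condProb_mul ρ (m' := m') hm' hA
  have i2 := integrable_condProb_mul ρ (m' := m') hm hA
  have i3 := integrable_condProb_mul ρ (m' := m) hm hA
  have cross : ∫ x, condProb ρ m A x * condProb ρ m' A x ∂ρ =
      ∫ x, condProb ρ m A x * condProb ρ m A x ∂ρ := by
    have h1 := condExp_mul_of_stronglyMeasurable_left (m := m) (μ := ρ)
      (f := condProb ρ m A) (g := condProb ρ m' A) stronglyMeasurable_condExp i2 integrable_condExp
    have h2 : ρ[condProb ρ m' A | m] =ᵐ[ρ] condProb ρ m A := condExp_condExp_of_le hmm hm'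
    calc ∫ x, condProb ρ m A x * condProb ρ m' A x ∂ρ
        = ∫ x, (ρ[condProb ρ m A * condProb ρ m' A | m]) x ∂ρ := (integral_condExp hm).symm
      _ = ∫ x, condProb ρ m A x * condProb ρ m A x ∂ρ := by
          refine integral_congr_ae ?_
          filter_upwards [h1, h2] with x hx1 hx2
          rw [hx1, Pi.mul_apply, hx2]
  have expand : ∀ x, (condProb ρ m' A x - condProb ρ m A x) ^ 2 =
      condProb ρ m' A x * condProb ρ m' A x - 2 * (condProb ρ m A x * condProb ρ m' A x)
        + condProb ρ m A x * condProb ρ m A x := fun x => by ring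
  simp_rw [condEnergy, expand, sq]
  have i12 : Integrable (fun x => condProb ρ m' A x * condProb ρ m' A x
      - 2 * (condProb ρ m A x * condProb ρ m' A x)) ρ := i1.sub (i2.const_mul 2)
  rw [integral_add i12 i3, integral_sub i1 (i2.const_mul 2), integral_const_mul, cross]
  ring

theorem condEnergy_mono (ρ : Measure Ω) [IsFiniteMeasure ρ] {m m' : MeasurableSpace Ω}
    (hmm : m ≤ m') (hm' : m' ≤ mΩ) {A : Set Ω} (hA : MeasurableSet[mΩ] A) :
    condEnergy ρ m A ≤ condEnergy ρ m' A := by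
  rw [← sub_nonneg, ← integral_sq_sub_condProb ρ hmm hm' hA]
  exact integral_nonneg fun x => sq_nonneg _

theorem condProb_ae_eq_of_condEnergy_le (ρ : Measure Ω) [IsFiniteMeasure ρ]
    {m m' : MeasurableSpace Ω} (hmm : m ≤ m') (hm' : m' ≤ mΩ) {A : Set Ω} (hA : MeasurableSet[mΩ] A)
    (h : condEnergy ρ m' A ≤ condEnergy ρ m A) : condProb ρ m' A =ᵐ[ρ] condProb ρ m A := by
  have hm : m ≤ mΩ := hmm.trans hm'
  have h0 : ∫ x, (condProb ρ m' A x - condProb ρ m A x) ^ 2 ∂ρ = 0 :=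
    le_antisymm (by rw [integral_sq_sub_condProb ρ hmm hm' hA]; linarith)
      (integral_nonneg fun x => sq_nonneg _)
  have hint : Integrable (fun x => (condProb ρ m' A x - condProb ρ m A x) ^ 2) ρ := by
    refine (((integrable_condProb_mul ρ (m' := m') hm' hA).sub
      ((integrable_condProb_mul ρ (m' := m') hm hA).const_mul 2)).add
        (integrable_condProb_mul ρ (m' := m) hm hA)).congr (ae_of_all _ fun x => ?_)
    simp only [Pi.add_apply, Pi.sub_apply]
    ring
  rw [integral_eq_zero_iff_of_nonneg (fun x => sq_nonneg _) hint] at h0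
  filter_upwards [h0] with x hx
  exact sub_eq_zero.1 (pow_eq_zero_iff two_ne_zero |>.1 hx)

theorem integral_comp_measurePreserving {ρ : Measure Ω} {ρ' : Measure Ω'} {π : Ω → Ω'}
    (hπ : MeasurePreserving π ρ ρ') {f : Ω' → ℝ} (hf : AEStronglyMeasurable f ρ') :
    ∫ x, f (π x) ∂ρ = ∫ y, f y ∂ρ' := by
  rw [← hπ.map_eq] at hf ⊢
  exact (integral_map hπ.measurable.aemeasurable hf).symm

theorem setIntegral_preimage_measurePreserving {ρ : Measure Ω} {ρ' : Measure Ω'} {π : Ω → Ω'}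
    (hπ : MeasurePreserving π ρ ρ') {f : Ω' → ℝ} (hf : AEStronglyMeasurable f ρ') {t : Set Ω'}
    (ht : MeasurableSet t) : ∫ x in π ⁻¹' t, f (π x) ∂ρ = ∫ y in t, f y ∂ρ' := by
  rw [← hπ.map_eq] at hf ⊢
  exact (setIntegral_map ht hf hπ.measurable.aemeasurable).symm

/-- Conditional probabilities are transported by factor maps. -/
theorem condProb_comp_measurePreserving {ρ : Measure Ω} {ρ' : Measure Ω'} [IsFiniteMeasure ρ]
    [IsFiniteMeasure ρ'] {π : Ω → Ω'} (hπ : MeasurePreserving π ρ ρ') {A : Set Ω'}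
    (hA : MeasurableSet A) {m : MeasurableSpace Ω'} (hm : m ≤ mΩ') :
    (fun x => condProb ρ' m A (π x)) =ᵐ[ρ] condProb ρ (m.comap π) (π ⁻¹' A) := by
  -- These facts concern the ambient σ-algebra of `Ω'`, and `m` must not be taken for it.
  revert m
  have hle : mΩ'.comap π ≤ mΩ := hπ.measurable.comap_le
  have hπA : MeasurableSet (π ⁻¹' A) := hπ.measurable hA
  have hcomp : ∀ {f : Ω' → ℝ}, Integrable f ρ' → Integrable (fun x => f (π x)) ρ :=
    hπ.integrable_comp_of_integrable
  intro m hm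
  have hmc : m.comap π ≤ mΩ :=
    (MeasurableSpace.comap_mono hm).trans hle
  have hmeas : StronglyMeasurable[m.comap π] fun x => condProb ρ' m A (π x) :=
    stronglyMeasurable_condExp.comp_measurable (comap_measurable π)
  have hint : Integrable (fun x => condProb ρ' m A (π x)) ρ :=
    hcomp integrable_condExp
  refine ae_eq_condExp_of_forall_setIntegral_eq hmc
    (integrable_indicator_one ρ hπA) (fun s _ _ => hint.integrableOn) ?_
    hmeas.aestronglyMeasurable
  rintro _ ⟨t, ht, rfl⟩ _
  exact (setIntegral_preimage_measurePreserving hπ integrable_condExp.aestronglyMeasurable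
    (hm _ ht)).trans ((setIntegral_condExp hm (integrable_indicator_one ρ' hA) ht).trans
      (setIntegral_preimage_measurePreserving hπ
        (integrable_indicator_one ρ' hA).aestronglyMeasurable (hm _ ht)).symm)

theorem condEnergy_of_measurePreserving {ρ : Measure Ω} {ρ' : Measure Ω'} [IsFiniteMeasure ρ]
    [IsFiniteMeasure ρ'] {π : Ω → Ω'} (hπ : MeasurePreserving π ρ ρ') {A : Set Ω'}
    (hA : MeasurableSet A) {m : MeasurableSpace Ω'} (hm : m ≤ mΩ') :
    condEnergy ρ' m A = condEnergy ρ (m.comap π) (π ⁻¹' A) := by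
  refine (integral_comp_measurePreserving hπ (f := fun y => condProb ρ' m A y ^ 2)
    ((stronglyMeasurable_condExp.mono hm).aestronglyMeasurable.pow 2)).symm.trans
      (integral_congr_ae ?_)
  filter_upwards [condProb_comp_measurePreserving hπ hA hm] with x hx
  rw [hx]

/-- If passing from `m` to the finer σ-algebra `m₂` does not change the conditional probability of
`s`, then `s` is conditionally independent over `m` of every set of `m₂`. -/
theorem condProb_inter_of_condProb_eq (ρ : Measure Ω) [IsFiniteMeasure ρ]
    {m m₂ : MeasurableSpace Ω} (hmm : m ≤ m₂) (hm₂ : m₂ ≤ mΩ) {s t : Set Ω}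
    (hs : MeasurableSet[mΩ] s) (ht : MeasurableSet[m₂] t)
    (h : condProb ρ m₂ s =ᵐ[ρ] condProb ρ m s) :
    condProb ρ m (s ∩ t) =ᵐ[ρ] condProb ρ m s * condProb ρ m t := by
  have hm : m ≤ mΩ := hmm.trans hm₂
  have hst : (s ∩ t).indicator (fun _ => (1 : ℝ)) = t.indicator (s.indicator fun _ => 1) := by
    rw [Set.indicator_indicator, Set.inter_comm]
  have h1 : ρ[condProb ρ m₂ (s ∩ t) | m] =ᵐ[ρ] condProb ρ m (s ∩ t) :=
    condExp_condExp_of_le hmm hm₂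
  have h2 : condProb ρ m₂ (s ∩ t) =ᵐ[ρ] condProb ρ m s * t.indicator (fun _ => 1) := by
    rw [condProb, hst]
    filter_upwards [condExp_indicator (integrable_indicator_one ρ hs) ht, h] with x hx hx'
    rw [hx, Pi.mul_apply]
    by_cases hxt : x ∈ t <;> simp [hxt, hx']
  have h3 : ρ[condProb ρ m s * t.indicator (fun _ => 1) | m] =ᵐ[ρ]
      condProb ρ m s * condProb ρ m t := by
    refine condExp_mul_of_stronglyMeasurable_left stronglyMeasurable_condExp ?_
      (integrable_indicator_one ρ (hm₂ _ ht))
    refine (integrable_indicator_one ρ (hm₂ _ ht)).bdd_mul (c := 1)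
      (stronglyMeasurable_condExp.mono hm).aestronglyMeasurable ?_
    filter_upwards [condProb_mem_Icc ρ hm hs] with x hx
    rw [Real.norm_of_nonneg hx.1]
    exact hx.2
  exact h1.symm.trans ((condExp_congr_ae h2).trans h3)

end CondEnergy

/-! ### Inverse limits of sequences of probability spaces -/

section InverseLimit

theorem map_compProd_comap {α β γ : Type*} [MeasurableSpace α] [MeasurableSpace β]
    [MeasurableSpace γ] (ρ : Measure α) [SFinite ρ] {g : α → β} (hg : Measurable g)
    (κ : Kernel β γ) [IsSFiniteKernel κ] :
    (ρ ⊗ₘ κ.comap g hg).map (Prod.map g id) = ρ.map g ⊗ₘ κ := by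
  ext s hs
  rw [Measure.map_apply (by fun_prop) hs, Measure.compProd_apply (hs.preimage (by fun_prop)),
    Measure.compProd_apply hs, lintegral_map (Kernel.measurable_kernel_prodMk_left hs) hg]
  rfl

/-- Inverse limits of sequences of probability spaces, in the form of the Markov chain whose
transition from time `n` to time `n + 1` is the disintegration of `ν (n + 1)` over `ν n`. -/
theorem exists_measure_pi_of_map_eq {X : ℕ → Type*} [∀ n, MeasurableSpace (X n)]
    [∀ n, StandardBorelSpace (X n)] (ν : ∀ n, Measure (X n)) [∀ n, IsProbabilityMeasure (ν n)]
    (p : ∀ n, X (n + 1) → X n) (hp : ∀ n, Measurable (p n))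
    (h : ∀ n, (ν (n + 1)).map (p n) = ν n) :
    ∃ ρ : Measure (∀ n, X n), IsProbabilityMeasure ρ ∧ (∀ n, ρ.map (fun x => x n) = ν n) ∧
      ∀ n, ∀ᵐ x ∂ρ, p n (x (n + 1)) = x n := by
  have hne : ∀ n, Nonempty (X n) := fun n => nonempty_of_isProbabilityMeasure (ν n)
  let g : ∀ n, (∀ i : Finset.Iic n, X i) → X n := fun n x => x ⟨n, Finset.mem_Iic.2 le_rfl⟩
  have hg : ∀ n, Measurable (g n) := fun n => measurable_pi_apply _
  let κ : ∀ n, Kernel (X n) (X (n + 1)) := fun n => condDistrib id (p n) (ν (n + 1))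
  let η : ∀ n, Kernel (∀ i : Finset.Iic n, X i) (X (n + 1)) := fun n => (κ n).comap (g n) (hg n)
  let ρ := Kernel.trajMeasure (ν 0) η
  have hpair : ∀ n, ρ.map (fun x => (x n, x (n + 1))) = ρ.map (fun x => x n) ⊗ₘ κ n := by
    intro n
    have h1 := congrArg (Measure.map (Prod.map (g n) id))
      (Kernel.map_frestrictLe_trajMeasure_compProd_eq_map_trajMeasure (μ₀ := ν 0) (κ := η)
        (a := n))
    rw [map_compProd_comap, Measure.map_map (hg n) (by fun_prop),
      Measure.map_map (by fun_prop) (by fun_prop)] at h1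
    exact h1.symm
  have hκ : ∀ n, ν n ⊗ₘ κ n = (ν (n + 1)).map (fun y => (p n y, y)) := by
    intro n
    have h1 : (ν (n + 1)).map (p n) ⊗ₘ κ n = (ν (n + 1)).map (fun y => (p n y, id y)) :=
      compProd_map_condDistrib aemeasurable_id
    rwa [h n] at h1
  have hmarg : ∀ n, ρ.map (fun x => x n) = ν n := by
    intro n
    induction n with
    | zero =>
      have h1 : (fun x : ∀ n, X n => x 0) = g 0 ∘ Preorder.frestrictLe 0 := rfl
      have h2 : g 0 ∘ (MeasurableEquiv.piUnique fun i : Finset.Iic 0 => X i).symm = id := by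
        ext y
        exact (MeasurableEquiv.piUnique fun i : Finset.Iic 0 => X i).apply_symm_apply y
      rw [h1, ← Measure.map_map (hg 0) (by fun_prop),
        show ρ = Kernel.trajMeasure (ν 0) η from rfl, Kernel.trajMeasure,
        Measure.map_comp _ _ (by fun_prop), Kernel.traj_map_frestrictLe, Kernel.partialTraj_self,
        Measure.id_comp]
      exact (Measure.map_map (hg 0) (MeasurableEquiv.measurable _)).trans
        ((congrArg (fun f => (ν 0).map f) h2).trans Measure.map_id)
    | succ n ih =>
      have h1 := congrArg (Measure.map Prod.snd) ((hpair n).trans (ih ▸ hκ n))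
      rw [Measure.map_map (by fun_prop) (by fun_prop),
        Measure.map_map (by fun_prop) (by fun_prop)] at h1
      exact h1.trans Measure.map_id
  refine ⟨ρ, inferInstance, hmarg, fun n => ?_⟩
  have hm : MeasurableSet {z : X n × X (n + 1) | p n z.2 = z.1} :=
    measurableSet_eq_fun (by fun_prop) (by fun_prop)
  have h1 : ∀ᵐ z ∂(ρ.map (fun x => (x n, x (n + 1)))), p n z.2 = z.1 := by
    rw [hpair, hmarg, hκ, ae_map_iff (by fun_prop) hm]
    simp
  exact ae_of_ae_map (by fun_prop) h1

end InverseLimit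

/-! ### Extensions of laws -/

section Extensions

variable {k : ℕ} {X Y Z : Type u} [MeasurableSpace X] [MeasurableSpace Y] [MeasurableSpace Z]
  {μ : Measure (Word k → X)} {ν : Measure (Word k → Y)} {ξ : Measure (Word k → Z)}
  {π : Y → X} {σ : Z → Y}

theorem measurable_comp_left {f : Y → X} (hf : Measurable f) :
    Measurable fun (y : Word k → Y) w => f (y w) :=
  measurable_pi_lambda _ fun w => hf.comp (measurable_pi_apply w)

theorem measurable_comp_right (φ : Word k → Word k) :
    Measurable fun (x : Word k → X) w => x (φ w) :=
  measurable_pi_lambda _ fun w => measurable_pi_apply (φ w)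

theorem IsExtension.refl (μ : Measure (Word k → X)) : IsExtension μ μ id :=
  ⟨measurable_id, Measure.map_id⟩

theorem IsExtension.trans (hσ : IsExtension ξ ν σ) (hπ : IsExtension ν μ π) :
    IsExtension ξ μ (π ∘ σ) := by
  refine ⟨hπ.measurable.comp hσ.measurable, ?_⟩
  rw [← hπ.map_eq, ← hσ.map_eq, Measure.map_map (measurable_comp_left hπ.measurable)
    (measurable_comp_left hσ.measurable)]
  rfl

theorem IsExtension.measurePreserving [NeZero k] (hπ : IsExtension ν μ π) :
    MeasurePreserving π (pointMarginal ν) (pointMarginal μ) := by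
  refine ⟨hπ.measurable, ?_⟩
  rw [pointMarginal, pointMarginal, ← hπ.map_eq, Measure.map_map hπ.measurable
    (measurable_pi_apply _), Measure.map_map (measurable_pi_apply _)
    (measurable_comp_left hπ.measurable)]
  rfl

theorem IsExtension.comap_insensitive_le (hπ : IsExtension ν μ π) (e : Finset (Fin k)) :
    (insensitive μ e).comap π ≤ insensitive ν e := by
  rintro _ ⟨A, ⟨hA, h⟩, rfl⟩
  refine ⟨hπ.measurable hA, fun n ℓ i hi j hj => ?_⟩
  have h1 := h n ℓ i hi j hj
  rw [← hπ.map_eq] at h1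
  exact ae_of_ae_map (measurable_comp_left hπ.measurable).aemeasurable h1

theorem IsExtension.comap_insensitiveJoin_le (hπ : IsExtension ν μ π)
    (𝓘 : Set (Finset (Fin k))) : (insensitiveJoin μ 𝓘).comap π ≤ insensitiveJoin ν 𝓘 := by
  simp only [insensitiveJoin, MeasurableSpace.comap_iSup]
  exact iSup₂_mono fun e _ => hπ.comap_insensitive_le e

/-- The energy of `A` with respect to `Φ_𝓘`, under the point-marginal of `μ`. -/
noncomputable def insensitiveEnergy [NeZero k] (μ : Measure (Word k → X))
    (𝓘 : Set (Finset (Fin k))) (A : Set X) : ℝ :=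
  condEnergy (pointMarginal μ) (insensitiveJoin μ 𝓘) A

theorem isProbabilityMeasure_pointMarginal [NeZero k] (μ : Measure (Word k → X))
    [IsProbabilityMeasure μ] : IsProbabilityMeasure (pointMarginal μ) :=
  Measure.isProbabilityMeasure_map (measurable_pi_apply _).aemeasurable

theorem insensitiveEnergy_le_one [NeZero k] [IsProbabilityMeasure μ] (𝓘 : Set (Finset (Fin k)))
    {A : Set X} (hA : MeasurableSet A) : insensitiveEnergy μ 𝓘 A ≤ 1 :=
  have := isProbabilityMeasure_pointMarginal μ
  condEnergy_le_one _ (insensitiveJoin_le μ 𝓘) hA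

theorem IsExtension.insensitiveEnergy_eq [NeZero k] [IsFiniteMeasure μ] [IsFiniteMeasure ν]
    (hπ : IsExtension ν μ π) (𝓘 : Set (Finset (Fin k))) {A : Set X} (hA : MeasurableSet A) :
    insensitiveEnergy μ 𝓘 A =
      condEnergy (pointMarginal ν) ((insensitiveJoin μ 𝓘).comap π) (π ⁻¹' A) :=
  condEnergy_of_measurePreserving hπ.measurePreserving hA (insensitiveJoin_le μ 𝓘)

/-- Energies can only grow under extensions, since the preimage of an insensitive set is
insensitive. -/
theorem IsExtension.insensitiveEnergy_le [NeZero k] [IsFiniteMeasure μ] [IsFiniteMeasure ν]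
    (hπ : IsExtension ν μ π) (𝓘 : Set (Finset (Fin k))) {A : Set X} (hA : MeasurableSet A) :
    insensitiveEnergy μ 𝓘 A ≤ insensitiveEnergy ν 𝓘 (π ⁻¹' A) := by
  rw [hπ.insensitiveEnergy_eq 𝓘 hA]
  exact condEnergy_mono _ (hπ.comap_insensitiveJoin_le 𝓘) (insensitiveJoin_le ν 𝓘)
    (hπ.measurable hA)

end Extensions

/-! ### Inverse limits of strongly stationary laws -/

/-- A strongly stationary law, bundled with the standard Borel space on which it lives. -/
structure StationaryLaw (k : ℕ) where
  carrier : Type u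
  [measurableSpace : MeasurableSpace carrier]
  [standardBorelSpace : StandardBorelSpace carrier]
  law : Measure (Word k → carrier)
  [isProbabilityMeasure : IsProbabilityMeasure law]
  isStronglyStationary : IsStronglyStationary law

namespace StationaryLaw

attribute [instance] measurableSpace standardBorelSpace isProbabilityMeasure

variable {k : ℕ}

section InverseLimit

/-- The space of threads `(x₀, x₁, …)`, `p n (x (n + 1)) = x n`, of a sequence of maps. -/
abbrev Thread (S : ℕ → StationaryLaw.{u} k) (p : ∀ n, (S (n + 1)).carrier → (S n).carrier) :
    Type u :=
  {x : ∀ n, (S n).carrier // ∀ n, p n (x (n + 1)) = x n}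

variable {S : ℕ → StationaryLaw.{u} k} {p : ∀ n, (S (n + 1)).carrier → (S n).carrier}

theorem Thread.comap_eval_mono (hp : ∀ n, Measurable (p n)) :
    Monotone fun n => MeasurableSpace.comap (fun x : Thread S p => x.1 n) inferInstance := by
  refine monotone_nat_of_le_succ fun n => ?_
  have h : (fun x : Thread S p => x.1 n) = p n ∘ fun x => x.1 (n + 1) :=
    funext fun x => (x.2 n).symm
  rw [h, ← MeasurableSpace.comap_comp]
  exact MeasurableSpace.comap_mono (hp n).comap_le

theorem Thread.measurableSpace_eq_iSup :
    (inferInstance : MeasurableSpace (Thread S p)) =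
      ⨆ n, MeasurableSpace.comap (fun x : Thread S p => x.1 n) inferInstance := by
  change MeasurableSpace.comap Subtype.val MeasurableSpace.pi = _
  simp only [MeasurableSpace.pi, MeasurableSpace.comap_iSup, MeasurableSpace.comap_comp]
  rfl

theorem Thread.measure_ext (hp : ∀ n, Measurable (p n)) {ξ ξ' : Measure (Word k → Thread S p)}
    [IsFiniteMeasure ξ]
    (h : ∀ n, ξ.map (fun x w => (x w).1 n) = ξ'.map (fun x w => (x w).1 n)) : ξ = ξ' := by
  let Q : ∀ n, (Word k → Thread S p) → (Word k → (S n).carrier) := fun n x w => (x w).1 n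
  have hQ : ∀ n, Measurable (Q n) := fun n =>
    measurable_comp_left ((measurable_pi_apply n).comp measurable_subtype_coe)
  have hcomap : ∀ n, MeasurableSpace.comap (Q n) inferInstance = ⨆ w : Word k,
      MeasurableSpace.comap (fun x : Word k → Thread S p => x w)
        (MeasurableSpace.comap (fun x : Thread S p => x.1 n) inferInstance) := by
    intro n
    simp only [MeasurableSpace.pi, MeasurableSpace.comap_iSup, MeasurableSpace.comap_comp]
    rfl
  have hmono : Monotone fun n => MeasurableSpace.comap (Q n) inferInstance := by
    intro m n hmn
    simp only [hcomap]
    exact iSup_mono fun w => MeasurableSpace.comap_mono (Thread.comap_eval_mono hp hmn)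
  have hgen : (inferInstance : MeasurableSpace (Word k → Thread S p)) =
      ⨆ n, MeasurableSpace.comap (Q n) inferInstance := by
    simp only [hcomap]
    rw [iSup_comm]
    simp only [← MeasurableSpace.comap_iSup, ← Thread.measurableSpace_eq_iSup]
    rfl
  refine ext_of_generate_finite
    (⋃ n, {s | MeasurableSet[MeasurableSpace.comap (Q n) inferInstance] s})
    (hgen.trans (MeasurableSpace.generateFrom_iUnion_measurableSet _).symm)
    (isPiSystem_iUnion_of_monotone _ (fun n => @MeasurableSpace.isPiSystem_measurableSet _
      (MeasurableSpace.comap (Q n) inferInstance)) fun _ _ hmn => hmono hmn) ?_ ?_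
  · intro s hs
    obtain ⟨n, t, ht, rfl⟩ := Set.mem_iUnion.1 hs
    rw [← Measure.map_apply (hQ n) ht, ← Measure.map_apply (hQ n) ht, h n]
  · have h0 := congrArg (fun ρ => ρ Set.univ) (h 0)
    simpa [Measure.map_apply (hQ 0) MeasurableSet.univ, Q] using h0

theorem exists_inverseLimit (hp : ∀ n, IsExtension (S (n + 1)).law (S n).law (p n)) :
    ∃ (L : StationaryLaw.{u} k) (q : ∀ n, L.carrier → (S n).carrier),
      (∀ n, IsExtension L.law (S n).law (q n)) ∧ (∀ n, p n ∘ q (n + 1) = q n) ∧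
        L.measurableSpace = ⨆ n, MeasurableSpace.comap (q n) inferInstance := by
  have hpm : ∀ n, Measurable (p n) := fun n => (hp n).measurable
  obtain ⟨ρ, hρ, hmarg, hcompat⟩ := exists_measure_pi_of_map_eq (fun n => (S n).law)
    (fun n x w => p n (x w)) (fun n => measurable_comp_left (hpm n)) (fun n => (hp n).map_eq)
  let C : Set (∀ n, Word k → (S n).carrier) := {x | ∀ n, (fun w => p n (x (n + 1) w)) = x n}
  have hC : MeasurableSet C := by
    simp only [C, Set.ofPred_forall]
    refine MeasurableSet.iInter fun n => measurableSet_eq_fun ?_ (measurable_pi_apply n)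
    exact (measurable_comp_left (hpm n)).comp (measurable_pi_apply (n + 1))
  have hCae : ∀ᵐ x ∂ρ, x ∈ C := ae_all_iff.2 hcompat
  obtain ⟨c, hc⟩ := hCae.exists
  -- The incompatible sequences form a null set, on which any compatible one may be substituted.
  classical
  let r : (∀ n, Word k → (S n).carrier) → (∀ n, Word k → (S n).carrier) :=
    fun x => if x ∈ C then x else c
  have hr : Measurable r := Measurable.ite hC measurable_id measurable_const
  have hrC : ∀ x, r x ∈ C := fun x => by
    by_cases hx : x ∈ C
    · simp [r, hx]
    · simpa [r, hx] using hc
  let G : (∀ n, Word k → (S n).carrier) → (Word k → Thread S p) :=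
    fun x w => ⟨fun n => r x n w, fun n => congrFun (hrC x n) w⟩
  have hG : Measurable G := measurable_pi_lambda _ fun w => Measurable.subtype_mk <|
    measurable_pi_lambda _ fun n =>
      (measurable_pi_apply w).comp ((measurable_pi_apply n).comp hr)
  have hq : ∀ n, Measurable fun x : Thread S p => x.1 n := fun n =>
    (measurable_pi_apply n).comp measurable_subtype_coe
  have hT : MeasurableSet {x : ∀ n, (S n).carrier | ∀ n, p n (x (n + 1)) = x n} := by
    simp only [Set.ofPred_forall]
    exact MeasurableSet.iInter fun n => measurableSet_eq_fun
      ((hpm n).comp (measurable_pi_apply (n + 1))) (measurable_pi_apply n)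
  have hB : StandardBorelSpace (Thread S p) := hT.standardBorel
  have hP : IsProbabilityMeasure (ρ.map G) := Measure.isProbabilityMeasure_map hG.aemeasurable
  have hmap : ∀ n, (ρ.map G).map (fun x w => (x w).1 n) = (S n).law := by
    intro n
    rw [Measure.map_map (measurable_comp_left (hq n)) hG, ← hmarg n]
    refine Measure.map_congr ?_
    filter_upwards [hCae] with x hx
    simp [G, r, hx]
  have hss : IsStronglyStationary (ρ.map G) := by
    intro φ
    have : IsFiniteMeasure ((ρ.map G).map fun x v => x (φ v)) :=
      Measure.isFiniteMeasure_map _ _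
    refine Thread.measure_ext hpm fun n => ?_
    calc ((ρ.map G).map fun x v => x (φ v)).map (fun x w => (x w).1 n)
        = ((ρ.map G).map (fun x w => (x w).1 n)).map fun x v => x (φ v) := by
          rw [Measure.map_map (measurable_comp_left (hq n)) (measurable_comp_right _),
            Measure.map_map (measurable_comp_right _) (measurable_comp_left (hq n))]
          rfl
      _ = (ρ.map G).map (fun x w => (x w).1 n) := by
          rw [hmap n, (S n).isStronglyStationary φ]
  exact ⟨⟨Thread S p, ρ.map G, hss⟩, fun n x => x.1 n, fun n => ⟨hq n, hmap n⟩,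
    fun n => funext fun x => x.2 n, Thread.measurableSpace_eq_iSup⟩

end InverseLimit

end StationaryLaw

/-! ### The sated extension -/

theorem exists_seq_isPiSystem_generateFrom (X : Type*) [m : MeasurableSpace X]
    [MeasurableSpace.CountablyGenerated X] :
    ∃ g : ℕ → Set X, (∀ j, MeasurableSet (g j)) ∧ IsPiSystem (Set.range g) ∧
      MeasurableSpace.generateFrom (Set.range g) = m := by
  let 𝒜 : Set (Set X) := generateSetAlgebra (MeasurableSpace.countableGeneratingSet X)
  have hc : 𝒜.Countable :=
    countable_generateSetAlgebra MeasurableSpace.countable_countableGeneratingSet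
  have hgen : MeasurableSpace.generateFrom 𝒜 = m := by
    rw [generateFrom_generateSetAlgebra_eq, MeasurableSpace.generateFrom_countableGeneratingSet]
  obtain ⟨g, hg⟩ := hc.exists_eq_range ⟨∅, isSetAlgebra_generateSetAlgebra.empty_mem⟩
  refine ⟨g, fun j => ?_, ?_, by rw [← hg, hgen]⟩
  · rw [← hgen]
    exact MeasurableSpace.measurableSet_generateFrom (hg ▸ Set.mem_range_self j)
  · rw [← hg]
    exact fun s hs t ht _ => isSetAlgebra_generateSetAlgebra.inter_mem hs ht

namespace StationaryLaw

variable {k : ℕ} [NeZero k]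

/-- Some extension has the property that no further extension increases the energy of `A` by more
than `ε`: any extension whose energy is within `ε` of the supremum over all extensions will do. -/
theorem exists_extension_nearly_maximal (S : StationaryLaw.{u} k) (𝓘 : Set (Finset (Fin k)))
    (A : Set S.carrier) (hA : MeasurableSet A) {ε : ℝ} (hε : 0 < ε) :
    ∃ (S' : StationaryLaw.{u} k) (π : S'.carrier → S.carrier), IsExtension S'.law S.law π ∧
      ∀ (S'' : StationaryLaw.{u} k) (σ : S''.carrier → S'.carrier),
        IsExtension S''.law S'.law σ →
          insensitiveEnergy S''.law 𝓘 (σ ⁻¹' (π ⁻¹' A)) ≤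
            insensitiveEnergy S'.law 𝓘 (π ⁻¹' A) + ε := by
  let E : Set ℝ := {a | ∃ (S' : StationaryLaw.{u} k) (π : S'.carrier → S.carrier),
    IsExtension S'.law S.law π ∧ insensitiveEnergy S'.law 𝓘 (π ⁻¹' A) = a}
  have hne : E.Nonempty := ⟨_, S, id, IsExtension.refl _, rfl⟩
  have hbdd : BddAbove E := by
    refine ⟨1, ?_⟩
    rintro _ ⟨S', π, hπ, rfl⟩
    exact insensitiveEnergy_le_one 𝓘 (hπ.measurable hA)
  obtain ⟨_, ⟨S', π, hπ, rfl⟩, hlt⟩ := exists_lt_of_lt_csSup hne (sub_lt_self (sSup E) hε)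
  refine ⟨S', π, hπ, fun S'' σ hσ => ?_⟩
  have h : insensitiveEnergy S''.law 𝓘 (σ ⁻¹' (π ⁻¹' A)) ≤ sSup E :=
    le_csSup hbdd ⟨S'', π ∘ σ, hσ.trans hπ, rfl⟩
  linarith

/-- The sequence of extensions behind the sated extension. Here `T n` lists sets to be treated at
stage `n`: the `T n (Nat.pair n j)` form a π-system generating the σ-algebra of stage `n`, and a set
that has appeared by stage `n` is lifted under its old index. In passing from stage `n` to stage
`n + 1`, the task `e n = (r, i, 𝓘)` is to make the energy of the set with index `i` with respect to
`Φ_𝓘` maximal up to `1 / (r + 1)`. -/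
theorem exists_extension_sequence (S₀ : StationaryLaw.{u} k)
    (e : ℕ → ℕ × ℕ × Set (Finset (Fin k))) :
    ∃ (S : ℕ → StationaryLaw.{u} k) (p : ∀ n, (S (n + 1)).carrier → (S n).carrier)
      (T : ∀ n, ℕ → Set (S n).carrier) (π : (S 0).carrier → S₀.carrier),
      IsExtension (S 0).law S₀.law π ∧
      (∀ n, IsExtension (S (n + 1)).law (S n).law (p n)) ∧
      (∀ n i, MeasurableSet (T n i)) ∧
      (∀ n, IsPiSystem (Set.range fun j => T n (Nat.pair n j)) ∧
        MeasurableSpace.generateFrom (Set.range fun j => T n (Nat.pair n j)) =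
          (S n).measurableSpace) ∧
      (∀ n i, i.unpair.1 ≤ n → T (n + 1) i = p n ⁻¹' T n i) ∧
      ∀ n (R : StationaryLaw.{u} k) (σ : R.carrier → (S (n + 1)).carrier),
        IsExtension R.law (S (n + 1)).law σ →
          insensitiveEnergy R.law (e n).2.2 (σ ⁻¹' (p n ⁻¹' T n (e n).2.1)) ≤
            insensitiveEnergy (S (n + 1)).law (e n).2.2 (p n ⁻¹' T n (e n).2.1)
              + 1 / ((e n).1 + 1) := by
  choose g hg hpi hgen using fun S : StationaryLaw.{u} k =>
    exists_seq_isPiSystem_generateFrom S.carrier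
  choose F f hf hmax using fun (S : StationaryLaw.{u} k) 𝓘 A hA (r : ℕ) =>
    S.exists_extension_nearly_maximal 𝓘 A hA (Nat.one_div_pos_of_nat (α := ℝ) (n := r))
  let St : Type (u + 1) :=
    Σ S : StationaryLaw.{u} k, {T : ℕ → Set S.carrier // ∀ i, MeasurableSet (T i)}
  let nextLaw : ℕ → St → StationaryLaw.{u} k := fun n s =>
    F s.1 (e n).2.2 (s.2.1 (e n).2.1) (s.2.2 _) (e n).1
  let proj : ∀ n (s : St), (nextLaw n s).carrier → s.1.carrier := fun n s =>
    f s.1 (e n).2.2 (s.2.1 (e n).2.1) (s.2.2 _) (e n).1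
  have hproj : ∀ n s, IsExtension (nextLaw n s).law s.1.law (proj n s) := fun n s => hf _ _ _ _ _
  let next : ℕ → St → St := fun n s =>
    ⟨nextLaw n s, fun i => if i.unpair.1 ≤ n then proj n s ⁻¹' s.2.1 i
      else g (nextLaw n s) i.unpair.2, fun i => by
        dsimp only
        split_ifs
        · exact (hproj n s).measurable (s.2.2 i)
        · exact hg _ _⟩
  let seq : ℕ → St := fun n => Nat.rec ⟨S₀, fun i => g S₀ i.unpair.2, fun i => hg _ _⟩ next n
  have hT : ∀ n, (fun j => (seq n).2.1 (Nat.pair n j)) = g (seq n).1 := by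
    intro n
    funext j
    cases n with
    | zero => exact congrArg (g S₀) (by simp)
    | succ n =>
      have h : ¬ (Nat.pair (n + 1) j).unpair.1 ≤ n := by simp
      exact (if_neg h).trans (congrArg (g (nextLaw n (seq n))) (by simp))
  refine ⟨fun n => (seq n).1, fun n => proj n (seq n), fun n => (seq n).2.1, id,
    IsExtension.refl _, fun n => hproj n _, fun n => (seq n).2.2, fun n => ?_,
    fun n i hi => if_pos hi, fun n R σ hσ => hmax _ _ _ _ _ R σ hσ⟩
  rw [hT]
  exact ⟨hpi _, hgen _⟩

end StationaryLaw

/-- A law on an inverse limit is `𝓘`-sated as soon as no extension increases the energy of the sets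
of generating π-systems of the stages. -/
theorem IsSated.of_inverseLimit {k : ℕ} [NeZero k] (𝓘 : Set (Finset (Fin k)))
    {L : StationaryLaw.{u} k} {Z : ℕ → Type u} [mZ : ∀ n, MeasurableSpace (Z n)]
    {q : ∀ n, L.carrier → Z n} (hq : ∀ n, Measurable (q n))
    (hmono : Monotone fun n => MeasurableSpace.comap (q n) inferInstance)
    (hL : L.measurableSpace = ⨆ n, MeasurableSpace.comap (q n) inferInstance)
    {𝒞 : ∀ n, Set (Set (Z n))} (hpi : ∀ n, IsPiSystem (𝒞 n))
    (hgen : ∀ n, MeasurableSpace.generateFrom (𝒞 n) = mZ n)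
    (hmax : ∀ n, ∀ A ∈ 𝒞 n, ∀ (R : StationaryLaw.{u} k) (π : R.carrier → L.carrier),
      IsExtension R.law L.law π →
        insensitiveEnergy R.law 𝓘 (π ⁻¹' (q n ⁻¹' A)) ≤ insensitiveEnergy L.law 𝓘 (q n ⁻¹' A)) :
    IsSated L.law 𝓘 := by
  intro Y _ _ ν _ π hν hπ
  have hcomap : MeasurableSpace.comap π L.measurableSpace =
      ⨆ n, MeasurableSpace.comap (q n ∘ π) inferInstance := by
    rw [hL]
    simp only [MeasurableSpace.comap_iSup, MeasurableSpace.comap_comp]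
  have hqπ : ∀ n, Measurable (q n ∘ π) := fun n => (hq n).comp hπ.measurable
  have hA : ∀ n, ∀ A ∈ 𝒞 n, MeasurableSet A := fun n A hA => by
    rw [← hgen n]
    exact MeasurableSpace.measurableSet_generateFrom hA
  have hle := hπ.comap_insensitiveJoin_le 𝓘
  have hle' := insensitiveJoin_le ν 𝓘
  have key : ∀ n, CondIndep ((insensitiveJoin L.law 𝓘).comap π)
      (MeasurableSpace.comap (q n ∘ π) inferInstance) (insensitiveJoin ν 𝓘)
      (comap_insensitiveJoin_le L.law 𝓘 hπ.measurable) (pointMarginal ν) := by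
    intro n
    refine CondIndepSets.condIndep (p1 := {s | ∃ t ∈ 𝒞 n, (q n ∘ π) ⁻¹' t = s})
      (p2 := {t | MeasurableSet[insensitiveJoin ν 𝓘] t}) (hqπ n).comap_le hle'
      ((hpi n).comap _) (@MeasurableSpace.isPiSystem_measurableSet _ (insensitiveJoin ν 𝓘))
      ?_ (@MeasurableSpace.generateFrom_measurableSet _ (insensitiveJoin ν 𝓘)).symm ?_
    · rw [← hgen n, MeasurableSpace.comap_generateFrom]
      rfl
    · rw [condIndepSets_iff]
      · rintro _ t ⟨A, hAn, rfl⟩ ht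
        refine condProb_inter_of_condProb_eq _ hle hle' (hqπ n (hA n A hAn)) ht ?_
        refine condProb_ae_eq_of_condEnergy_le _ hle hle' (hqπ n (hA n A hAn)) ?_
        exact (hmax n A hAn ⟨Y, ν, hν⟩ π hπ).trans_eq
          (hπ.insensitiveEnergy_eq 𝓘 (hq n (hA n A hAn)))
      · rintro _ ⟨A, hAn, rfl⟩
        exact hqπ n (hA n A hAn)
      · exact fun t ht => hle' _ ht
  change CondIndep _ (MeasurableSpace.comap π L.measurableSpace) _ _ _
  rw [hcomap]
  refine condIndep_iSup_of_monotone key (fun n => (hqπ n).comap_le) hle' fun m n hmn => ?_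
  simp only [← MeasurableSpace.comap_comp]
  exact MeasurableSpace.comap_mono (hmono hmn)

/-- Every strongly stationary law has a strongly stationary extension that is sated for all families
at once. -/
theorem StationaryLaw.exists_extension_isSated {k : ℕ} [NeZero k] (S₀ : StationaryLaw.{u} k) :
    ∃ (L : StationaryLaw.{u} k) (π : L.carrier → S₀.carrier),
      IsExtension L.law S₀.law π ∧ ∀ 𝓘 : Set (Finset (Fin k)), IsSated L.law 𝓘 := by
  obtain ⟨e, he⟩ := exists_surjective_nat (ℕ × ℕ × Set (Finset (Fin k)))
  obtain ⟨S, p, T, π₀, hπ₀, hp, hT, hgen, hlift, hmax⟩ := S₀.exists_extension_sequence e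
  obtain ⟨L, q, hq, hpq, hL⟩ := exists_inverseLimit hp
  refine ⟨L, π₀ ∘ q 0, (hq 0).trans hπ₀, fun 𝓘 => ?_⟩
  refine IsSated.of_inverseLimit 𝓘 (fun n => (hq n).measurable) ?_ hL (fun n => (hgen n).1)
    (fun n => (hgen n).2) ?_
  · refine monotone_nat_of_le_succ fun n => ?_
    rw [← hpq n, ← MeasurableSpace.comap_comp]
    exact MeasurableSpace.comap_mono (hp n).measurable.comap_le
  rintro n _ ⟨j, rfl⟩ R π hπ
  -- The preimage in the limit of the set with index `i` does not depend on the stage.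
  have hstage : ∀ N, n ≤ N → q N ⁻¹' T N (Nat.pair n j) = q n ⁻¹' T n (Nat.pair n j) := by
    intro N hN
    induction N, hN using Nat.le_induction with
    | base => rfl
    | succ N hN ih =>
      rw [hlift N _ (by simpa using hN), ← Set.preimage_comp, hpq, ih]
  -- There is a stage for each precision `r`; they are distinct, hence almost all later than `n`.
  choose s hs using fun r : ℕ => he (r, Nat.pair n j, 𝓘)
  have hinj : Function.Injective s := fun a b hab => by
    have h := (hs a).symm.trans ((congrArg e hab).trans (hs b))
    exact congrArg Prod.fst h
  have hle : ∀ᶠ r : ℕ in Filter.atTop,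
      insensitiveEnergy R.law 𝓘 (π ⁻¹' (q n ⁻¹' T n (Nat.pair n j))) ≤
        insensitiveEnergy L.law 𝓘 (q n ⁻¹' T n (Nat.pair n j)) + 1 / ((r : ℝ) + 1) := by
    filter_upwards [hinj.nat_tendsto_atTop.eventually_ge_atTop n] with r hr
    have h1 := hmax (s r) R (q (s r + 1) ∘ π) (hπ.trans (hq _))
    have h2 := (hq (s r + 1)).insensitiveEnergy_le 𝓘
      ((hp (s r)).measurable (hT (s r) (Nat.pair n j)))
    simp only [hs] at h1
    rw [Set.preimage_comp] at h1
    rw [← Set.preimage_comp (f := q (s r + 1)), hpq, hstage _ hr] at h1 h2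
    linarith
  have hlim := (tendsto_one_div_add_atTop_nhds_zero_nat (𝕜 := ℝ)).const_add
    (insensitiveEnergy L.law 𝓘 (q n ⁻¹' T n (Nat.pair n j)))
  rw [add_zero] at hlim
  exact ge_of_tendsto hlim hle

end DHJ

theorem theorem5p4 {k : ℕ} [NeZero k] {X : Type u} [MeasurableSpace X] [StandardBorelSpace X]
    (μ : MeasureTheory.Measure (DHJ.Word k → X)) [MeasureTheory.IsProbabilityMeasure μ]
    (hμ : DHJ.IsStronglyStationary μ) :
    ∃ (Y : Type u) (_ : MeasurableSpace Y) (_ : StandardBorelSpace Y)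
      (ν : MeasureTheory.Measure (DHJ.Word k → Y)) (_ : MeasureTheory.IsProbabilityMeasure ν)
      (π : Y → X),
      DHJ.IsStronglyStationary ν ∧ DHJ.IsExtension ν μ π ∧ DHJ.IsFullySated ν := by
  obtain ⟨L, π, hπ, hL⟩ :=
    DHJ.StationaryLaw.exists_extension_isSated (DHJ.StationaryLaw.mk X μ hμ)
  exact ⟨L.carrier, L.measurableSpace, L.standardBorelSpace, L.law, L.isProbabilityMeasure, π,
    L.isStronglyStationary, hπ, fun 𝓘 _ _ _ => hL 𝓘⟩
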